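/- Let $d\ge 1$ and let $\phi:\mathbb{R}^d\to\mathbb{R}$ be convex and Lipschitz continuous, with smallest Lipschitz constant $\mathrm{Lip}(\phi)$ for the Euclidean norm. Let $B(x,r)$ denote the closed Euclidean ball, let $\partial\phi(x)=\{g\in\mathbb{R}^d : \phi(z)\ge\phi(x)+\langle g,z-x\rangle \text{ for all } z\in\mathbb{R}^d\}$ be the subdifferential, and let $\partial\phi(A)=\bigcup_{y\in A}\partial\phi(y)$ for $A\subseteq\mathbb{R}^d$. For $\alpha,\eta>0$ put $$\Sigma_{\eta,\alpha}=\{x\in\mathbb{R}^d : \mathrm{diam}(\partial\phi(B(x,\eta)))\ge\alpha\},\qquad \Sigma_\alpha=\{x\in\mathbb{R}^d : \mathrm{diam}(\partial\phi(x))\ge\alpha\}.$$ Let $\mathcal{N}(K,r)$ be the minimum number of open balls of radius $r$, with arbitrary centers, needed to cover $K\subset\mathbb{R}^d$. Then for all $R>0$, $\alpha>0$ and $\eta>0$, $$\mathcal{N}(\Sigma_{\eta,\alpha}\cap B(0,R),\,8\eta)\le 48\,d^2\,(R+4\eta)^{d-1}\,\frac{\mathrm{Lip}(\phi)}{\alpha\,\eta^{d-1}}.$$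 In particular, there is a constant $c_d$ depending only on $d$ such that, for all such $\phi$ and all $R,\alpha>0$, $$\mathcal{H}^{d-1}(\Sigma_\alpha\cap B(0,R))\le c_d\,\frac{\mathrm{Lip}(\phi)\,R^{d-1}}{\alpha},$$ where $\mathcal{H}^{d-1}$ is the $(d-1)$-dimensional Hausdorff measure. -/

import Mathlib

open scoped NNReal ENNReal

namespace ConvexSingular

/-- The subdifferential `∂φ(x)`: all `g` with `φ(z) ≥ φ(x) + ⟪g, z - x⟫` for every `z`. -/
def subdifferential {d : ℕ} (φ : EuclideanSpace ℝ (Fin d) → ℝ) (x : EuclideanSpace ℝ (Fin d)) :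
    Set (EuclideanSpace ℝ (Fin d)) :=
  {g | ∀ z, φ x + inner ℝ g (z - x) ≤ φ z}

/-- The image `∂φ(A) = ⋃_{y ∈ A} ∂φ(y)`. -/
def subdifferentialImage {d : ℕ} (φ : EuclideanSpace ℝ (Fin d) → ℝ)
    (A : Set (EuclideanSpace ℝ (Fin d))) : Set (EuclideanSpace ℝ (Fin d)) :=
  ⋃ y ∈ A, subdifferential φ y

/-- `Σ_{η,α}`: the points `x` with `diam ∂φ(B(x,η)) ≥ α`, where `B(x,η)` is the closed ball. -/
def nearSingularSet {d : ℕ} (φ : EuclideanSpace ℝ (Fin d) → ℝ) (η α : ℝ) :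
    Set (EuclideanSpace ℝ (Fin d)) :=
  {x | ENNReal.ofReal α ≤ Metric.ediam (subdifferentialImage φ (Metric.closedBall x η))}

/-- `Σ_α`: the points `x` with `diam ∂φ(x) ≥ α`. -/
def singularSet {d : ℕ} (φ : EuclideanSpace ℝ (Fin d) → ℝ) (α : ℝ) :
    Set (EuclideanSpace ℝ (Fin d)) :=
  {x | ENNReal.ofReal α ≤ Metric.ediam (subdifferential φ x)}

/-- `𝒩(K, r)`: the least number of open balls of radius `r` (centred anywhere in the space) needed
to cover `K`. It is at least the number of closed balls of radius `r` needed, so an upper bound on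
it also holds for closed balls. -/
noncomputable def openCoveringNumber {d : ℕ} (K : Set (EuclideanSpace ℝ (Fin d))) (r : ℝ) : ℕ∞ :=
  ⨅ (C : Set (EuclideanSpace ℝ (Fin d))) (_ : K ⊆ ⋃ z ∈ C, Metric.ball z r), C.encard

/-- `Lip(φ)`: the smallest Lipschitz constant of a Lipschitz function `φ`. -/
noncomputable def lipConst {d : ℕ} (φ : EuclideanSpace ℝ (Fin d) → ℝ) : ℝ≥0 :=
  sInf {K : ℝ≥0 | LipschitzWith K φ}

/-- The infimum defining `lipConst` is attained. -/
theorem lipschitzWith_lipConst {d : ℕ} {φ : EuclideanSpace ℝ (Fin d) → ℝ}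
    (h : ∃ K : ℝ≥0, LipschitzWith K φ) : LipschitzWith (lipConst φ) φ := by
  have hc : IsClosed {K : ℝ≥0 | LipschitzWith K φ} := by
    have : {K : ℝ≥0 | LipschitzWith K φ} =
        ⋂ x, ⋂ y, {K : ℝ≥0 | dist (φ x) (φ y) ≤ K * dist x y} := by
      ext K
      simp [lipschitzWith_iff_dist_le_mul]
    rw [this]
    refine isClosed_iInter fun x => isClosed_iInter fun y => ?_
    exact isClosed_le continuous_const (by fun_prop)
  exact hc.csInf_mem h (OrderBot.bddBelow _)

end ConvexSingular

/-! The distributional Laplacian of a convex `φ` is nonnegative, hence monotone in the test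
function; near each point of `Σ_{η,α}` it has mass of order at least `α η^(d-1)`, while its mass
near `B(0,R)` is controlled by `Lip(φ)`. The pairing used is `-∫ ⟪∇φ, ∇ψ⟫` with Lipschitz, compactly
supported `ψ`.

Take an `8η`-separated finite set in `Σ_{η,α} ∩ B(0,R)` and attach to each point a truncated
paraboloid of radius `3η`. These have disjoint supports, so their sum lies below one truncated cone
(`sum_paraboloid_le_truncatedCone`), and `sum_neg_integral_inner_gradient_le` compares the pairings.
The cone has slope at most `3η`, supported in an annulus of width `3η/2`, which gives the upper
bound. Each paraboloid is bounded below by `le_neg_integral_inner_gradient_paraboloid`, using two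
distant subgradients. This bounds the cardinality; a maximal separated set is a covering. The
Hausdorff bound follows as `η → 0`. -/

namespace ConvexSingular

open MeasureTheory Set Filter Metric Topology

/-! ### Weak nonnegativity of pure second derivatives. -/

section WeakForm

variable {E : Type*} [NormedAddCommGroup E] [NormedSpace ℝ E]

/-- Both `s + t` and `s'` lie in `[s, s' + t]`, with interchanged convex weights; adding the two
convexity inequalities gives the claim. -/
theorem monotone_sub_along_line {φ : E → ℝ} (hφ : ConvexOn ℝ univ φ) (x v : E) {t : ℝ}
    (ht : 0 ≤ t) : Monotone fun s : ℝ => φ (x + s • v + t • v) - φ (x + s • v) := by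
  have hg : ConvexOn ℝ univ fun s : ℝ => φ (x + s • v) := by
    have := hφ.comp_affineMap (AffineMap.lineMap x (x + v))
    simpa [Function.comp_def, AffineMap.lineMap_apply, add_comm] using this
  intro s s' hs
  rcases hs.eq_or_lt with rfl | hs
  · rfl
  rcases ht.eq_or_lt with rfl | ht
  · simp
  have e : ∀ r : ℝ, x + r • v + t • v = x + (r + t) • v := fun r => by rw [add_smul, add_assoc]
  simp only [e]
  have h1 := hg.2 (mem_univ s) (mem_univ (s' + t))
    (div_nonneg (by linarith) (by linarith) : 0 ≤ (s' - s) / (s' - s + t))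
    (div_nonneg (by linarith) (by linarith) : 0 ≤ t / (s' - s + t))
    (by rw [← add_div, div_self]; linarith)
  have h2 := hg.2 (mem_univ s) (mem_univ (s' + t))
    (div_nonneg (by linarith) (by linarith) : 0 ≤ t / (s' - s + t))
    (div_nonneg (by linarith) (by linarith) : 0 ≤ (s' - s) / (s' - s + t))
    (by rw [← add_div, add_comm, div_self]; linarith)
  have hne : s' - s + t ≠ 0 := by linarith
  have e1 : ((s' - s) / (s' - s + t)) • s + (t / (s' - s + t)) • (s' + t) = s + t := by
    simp only [smul_eq_mul]; field_simp; ring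
  have e2 : (t / (s' - s + t)) • s + ((s' - s) / (s' - s + t)) • (s' + t) = s' := by
    simp only [smul_eq_mul]; field_simp; ring
  rw [e1] at h1
  rw [e2] at h2
  have e3 : (s' - s) / (s' - s + t) = 1 - t / (s' - s + t) := by field_simp; ring
  simp only [smul_eq_mul, e3] at h1 h2
  linarith

theorem lineDeriv_eq_zero_of_notMem_tsupport {χ : E → ℝ} {x : E} (hx : x ∉ tsupport χ) (v : E) :
    lineDeriv ℝ χ x v = 0 := by
  have h : χ =ᶠ[𝓝 x] fun _ => 0 := notMem_tsupport_iff_eventuallyEq.1 hx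
  rw [h.lineDeriv_eq]
  simp [lineDeriv]

variable [MeasurableSpace E] [BorelSpace E] [FiniteDimensional ℝ E] {μ : Measure E}
  [μ.IsAddHaarMeasure] {C D : ℝ≥0}

theorem integrable_lineDeriv {χ : E → ℝ} (hχ : LipschitzWith D χ) (hc : HasCompactSupport χ)
    (v : E) : Integrable (fun x => lineDeriv ℝ χ x v) μ := by
  have hs : Function.support (fun x => lineDeriv ℝ χ x v) ⊆ tsupport χ := fun x hx => by
    by_contra h
    exact hx (lineDeriv_eq_zero_of_notMem_tsupport h v)
  rw [← integrableOn_iff_integrable_of_support_subset hs]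
  exact (hχ.locallyIntegrable_lineDeriv v).integrableOn_isCompact hc

theorem integrable_lineDeriv_mul_lineDeriv {φ χ : E → ℝ} (hφ : LipschitzWith C φ)
    (hχ : LipschitzWith D χ) (hc : HasCompactSupport χ) (v w : E) :
    Integrable (fun x => lineDeriv ℝ φ x v * lineDeriv ℝ χ x w) μ :=
  (integrable_lineDeriv hχ hc w).mul_of_top_right (hφ.memLp_lineDeriv v)

/-- The pure second derivatives of a convex function are nonnegative in the weak sense. -/
theorem integral_lineDeriv_mul_lineDeriv_nonpos {φ χ : E → ℝ} (hconv : ConvexOn ℝ univ φ)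
    (hφ : LipschitzWith C φ) (hχ : LipschitzWith D χ) (hc : HasCompactSupport χ)
    (h0 : ∀ x, 0 ≤ χ x) (v : E) : ∫ x, lineDeriv ℝ φ x v * lineDeriv ℝ χ x v ∂μ ≤ 0 := by
  have key := hφ.integral_inv_smul_sub_mul_tendsto_integral_lineDeriv_mul
    (integrable_lineDeriv (μ := μ) hχ hc v) v
  refine le_of_tendsto key ?_
  filter_upwards [self_mem_nhdsWithin] with t (ht : 0 < t)
  -- At fixed `t` the increment of `φ` is Lipschitz, so the derivative can be moved from `χ` onto
  -- it.
  have hlip : LipschitzWith (C + C) fun x => φ (x + t • v) - φ x := by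
    have h1 : LipschitzWith C fun x => φ (x + t • v) := by
      have := hφ.comp (LipschitzWith.id.add (LipschitzWith.const (t • v)))
      simpa [Function.comp_def] using this
    exact h1.sub hφ
  have parts := hlip.integral_lineDeriv_mul_eq (μ := μ) hχ hc v
  have hnn : 0 ≤ ∫ x, lineDeriv ℝ (fun x => φ (x + t • v) - φ x) x v * χ x ∂μ := by
    refine integral_nonneg fun x => mul_nonneg ?_ (h0 x)
    -- Valid at every `x`: where the derivative fails to exist, `deriv` is `0`.
    exact (monotone_sub_along_line hconv x v ht.le).deriv_nonneg
  simp only [lineDeriv_neg, neg_mul, integral_neg] at parts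
  simp only [smul_eq_mul, mul_assoc, integral_const_mul]
  have : ∫ x, (φ (x + t • v) - φ x) * lineDeriv ℝ χ x v ∂μ =
      ∫ x, lineDeriv ℝ χ x v * (φ (x + t • v) - φ x) ∂μ := by simp only [mul_comm]
  rw [this]
  exact mul_nonpos_of_nonneg_of_nonpos (inv_nonneg.2 ht.le) (by linarith)

end WeakForm

/-! ### Subharmonicity and comparison of test functions. -/

section Gradient

variable {E : Type*} [NormedAddCommGroup E] [InnerProductSpace ℝ E] [FiniteDimensional ℝ E]
  [MeasurableSpace E] [BorelSpace E] {μ : Measure E} [μ.IsAddHaarMeasure] {C D : ℝ≥0}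

theorem ae_inner_gradient_eq_sum {φ χ : E → ℝ} (hφ : LipschitzWith C φ) (hχ : LipschitzWith D χ) :
    ∀ᵐ x ∂μ, inner ℝ (gradient φ x) (gradient χ x) =
      ∑ i, lineDeriv ℝ φ x (stdOrthonormalBasis ℝ E i) *
        lineDeriv ℝ χ x (stdOrthonormalBasis ℝ E i) := by
  filter_upwards [hφ.ae_differentiableAt (μ := μ), hχ.ae_differentiableAt (μ := μ)] with x h1 h2
  rw [← (stdOrthonormalBasis ℝ E).sum_inner_mul_inner]
  refine Finset.sum_congr rfl fun i _ => ?_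
  rw [h1.lineDeriv_eq_fderiv, h2.lineDeriv_eq_fderiv, real_inner_comm (gradient χ x)]
  simp [gradient]

theorem integrable_inner_gradient {φ χ : E → ℝ} (hφ : LipschitzWith C φ) (hχ : LipschitzWith D χ)
    (hc : HasCompactSupport χ) :
    Integrable (fun x => inner ℝ (gradient φ x) (gradient χ x)) μ := by
  refine (integrable_congr (ae_inner_gradient_eq_sum hφ hχ)).2 ?_
  exact integrable_finsetSum _ fun i _ => integrable_lineDeriv_mul_lineDeriv hφ hχ hc _ _

/-- A Lipschitz convex function is subharmonic in the weak sense. -/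
theorem integral_inner_gradient_nonpos {φ χ : E → ℝ} (hconv : ConvexOn ℝ univ φ)
    (hφ : LipschitzWith C φ) (hχ : LipschitzWith D χ) (hc : HasCompactSupport χ)
    (h0 : ∀ x, 0 ≤ χ x) : ∫ x, inner ℝ (gradient φ x) (gradient χ x) ∂μ ≤ 0 := by
  rw [integral_congr_ae (ae_inner_gradient_eq_sum hφ hχ),
    integral_finsetSum _ fun i _ => integrable_lineDeriv_mul_lineDeriv hφ hχ hc _ _]
  exact Finset.sum_nonpos fun i _ => integral_lineDeriv_mul_lineDeriv_nonpos hconv hφ hχ hc h0 _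

/-- Comparison: if `∑ ψ i ≤ ψ₀`, the Laplacian of `φ` tested against `∑ ψ i` is at most the one
tested against `ψ₀`. -/
theorem sum_neg_integral_inner_gradient_le {ι : Type*} {s : Finset ι} {φ ψ₀ : E → ℝ}
    {ψ : ι → E → ℝ} (hconv : ConvexOn ℝ univ φ) (hφ : LipschitzWith C φ)
    (hψ₀ : LipschitzWith D ψ₀) (hc₀ : HasCompactSupport ψ₀) {K : ℝ≥0}
    (hψ : ∀ i, LipschitzWith K (ψ i)) (hc : ∀ i, HasCompactSupport (ψ i))
    (hle : ∀ x, ∑ i ∈ s, ψ i x ≤ ψ₀ x) :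
    ∑ i ∈ s, -∫ x, inner ℝ (gradient φ x) (gradient (ψ i) x) ∂μ ≤
      -∫ x, inner ℝ (gradient φ x) (gradient ψ₀ x) ∂μ := by
  obtain ⟨M, hM⟩ : ∃ M, LipschitzWith M fun x => ∑ i ∈ s, ψ i x := by
    classical
    clear hle
    induction s using Finset.induction_on with
    | empty => exact ⟨0, by simp⟩
    | insert b t hb ih =>
      obtain ⟨M, hM⟩ := ih
      exact ⟨K + M, by simpa only [Finset.sum_insert hb] using (hψ b).add hM⟩
  have hcs : HasCompactSupport fun x => ∑ i ∈ s, ψ i x := by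
    classical
    clear hle hM
    induction s using Finset.induction_on with
    | empty => simp only [Finset.sum_empty]; exact HasCompactSupport.zero
    | insert b t hb ih => simp only [Finset.sum_insert hb]; exact (hc b).add ih
  -- The difference of the two sides is itself an admissible nonnegative test function.
  have h := integral_inner_gradient_nonpos (μ := μ) (χ := fun x => ψ₀ x - ∑ i ∈ s, ψ i x) hconv hφ
    (hψ₀.sub hM) (hc₀.sub hcs) fun x => sub_nonneg.2 (hle x)
  have hae : ∀ᵐ x ∂μ, inner ℝ (gradient φ x) (gradient (fun x => ψ₀ x - ∑ i ∈ s, ψ i x) x) =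
      inner ℝ (gradient φ x) (gradient ψ₀ x) -
        ∑ i ∈ s, inner ℝ (gradient φ x) (gradient (ψ i) x) := by
    have hall : ∀ᵐ x ∂μ, ∀ i ∈ s, DifferentiableAt ℝ (ψ i) x :=
      (ae_ball_iff s.countable_toSet).2 fun i _ => (hψ i).ae_differentiableAt
    filter_upwards [hψ₀.ae_differentiableAt (μ := μ), hall] with x h1 h2
    have hg : gradient (fun x => ψ₀ x - ∑ i ∈ s, ψ i x) x =
        gradient ψ₀ x - ∑ i ∈ s, gradient (ψ i) x := by
      have hs : HasFDerivAt (fun x => ∑ i ∈ s, ψ i x) (∑ i ∈ s, fderiv ℝ (ψ i) x) x :=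
        HasFDerivAt.fun_sum fun i hi => (h2 i hi).hasFDerivAt
      simp only [gradient]
      rw [(h1.hasFDerivAt.fun_sub hs).fderiv, map_sub, map_sum]
    rw [hg, inner_sub_right, inner_sum]
  rw [integral_congr_ae hae, integral_sub (integrable_inner_gradient hφ hψ₀ hc₀)
    (integrable_finsetSum _ fun i _ => integrable_inner_gradient hφ (hψ i) (hc i)),
    integral_finsetSum _ fun i _ => integrable_inner_gradient hφ (hψ i) (hc i)] at h
  rw [Finset.sum_neg_distrib]
  linarith

end Gradient

/-! ### Test functions: paraboloids and the cone above them. -/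

/-- The truncated paraboloid `(ρ² - ‖z - y‖²)₊ / 2`. -/
noncomputable def paraboloid {E : Type*} [NormedAddCommGroup E] (ρ : ℝ) (y z : E) : ℝ :=
  max ((ρ ^ 2 - ‖z - y‖ ^ 2) / 2) 0

/-- The truncated cone `min (ρ² / 2) (ρ (S - ‖z‖))₊`. -/
noncomputable def truncatedCone {E : Type*} [NormedAddCommGroup E] (ρ S : ℝ) (z : E) : ℝ :=
  max (min (ρ ^ 2 / 2) (ρ * (S - ‖z‖))) 0

section Bumps

variable {E : Type*} [NormedAddCommGroup E]

theorem paraboloid_eq_zero {ρ : ℝ} (hρ : 0 ≤ ρ) {y z : E} (h : ρ ≤ ‖z - y‖) :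
    paraboloid ρ y z = 0 := by
  have : ρ ^ 2 ≤ ‖z - y‖ ^ 2 := by gcongr
  exact max_eq_right (by linarith)

theorem lipschitzWith_paraboloid {ρ : ℝ} (hρ : 0 ≤ ρ) (y : E) :
    LipschitzWith ρ.toNNReal (paraboloid ρ y) := by
  lift ρ to ℝ≥0 using hρ
  rw [Real.toNNReal_coe]
  refine LipschitzWith.of_le_add_mul _ fun z w => ?_
  have h : ‖w - y‖ ≤ ‖z - y‖ + dist z w := by
    rw [dist_comm, dist_eq_norm]
    calc ‖w - y‖ = ‖(z - y) + (w - z)‖ := by congr 1; abel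
      _ ≤ _ := norm_add_le _ _
  have ha := norm_nonneg (z - y)
  have hb := norm_nonneg (w - y)
  have hd : 0 ≤ dist z w := dist_nonneg
  have hρ : 0 ≤ (ρ : ℝ) := ρ.2
  unfold paraboloid
  refine max_le ?_ (by positivity)
  rcases le_total ‖w - y‖ ρ with hw | hw
  · refine le_trans ?_ (add_le_add_left (le_max_left _ _) _)
    rcases le_total ‖w - y‖ ‖z - y‖ with hz | hz
    · nlinarith [mul_nonneg hρ hd]
    · nlinarith [mul_nonneg hρ hd]
  · refine le_trans ?_ (add_le_add_left (le_max_right _ _) _)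
    rcases le_total ‖z - y‖ ρ with hz | hz
    · nlinarith [mul_nonneg hρ hd]
    · nlinarith [mul_nonneg hρ hd]

theorem lipschitzWith_truncatedCone {ρ : ℝ} (hρ : 0 ≤ ρ) (S : ℝ) :
    LipschitzWith ρ.toNNReal (truncatedCone ρ S : E → ℝ) := by
  lift ρ to ℝ≥0 using hρ
  rw [Real.toNNReal_coe]
  refine LipschitzWith.of_le_add_mul _ fun z w => ?_
  have h : ‖w‖ ≤ ‖z‖ + dist z w := by
    rw [dist_comm, dist_eq_norm]
    calc ‖w‖ = ‖z + (w - z)‖ := by congr 1; abel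
      _ ≤ _ := norm_add_le _ _
  have hd : 0 ≤ (ρ : ℝ) * dist z w := mul_nonneg ρ.2 dist_nonneg
  have h' : (ρ : ℝ) * (S - ‖z‖) ≤ ρ * (S - ‖w‖) + ρ * dist z w := by
    rw [← mul_add]
    exact mul_le_mul_of_nonneg_left (by linarith) ρ.2
  unfold truncatedCone
  refine max_le ?_ (by positivity)
  refine le_trans ?_ (add_le_add_left (le_max_left _ _) _)
  rw [← min_add_add_right]
  exact min_le_min (by linarith) h'

theorem truncatedCone_eq_zero {ρ S : ℝ} (hρ : 0 ≤ ρ) {z : E} (h : S ≤ ‖z‖) :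
    truncatedCone ρ S z = 0 :=
  max_eq_right ((min_le_right _ _).trans (mul_nonpos_of_nonneg_of_nonpos hρ (by linarith)))

theorem truncatedCone_eq_of_le {ρ S : ℝ} (hρ : 0 ≤ ρ) {z : E} (h : ‖z‖ ≤ S - ρ / 2) :
    truncatedCone ρ S z = ρ ^ 2 / 2 := by
  have : ρ ^ 2 / 2 ≤ ρ * (S - ‖z‖) := by nlinarith
  rw [truncatedCone, min_eq_left this, max_eq_left (by positivity)]

/-- With `t = ‖z - y‖ ≤ ρ`, `(ρ² - t²)/2 = (ρ - t)(ρ + t)/2 ≤ ρ(ρ - t)`, and `ρ - t ≤ S - ‖z‖`. -/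
theorem paraboloid_le_truncatedCone {ρ S : ℝ} (hρ : 0 ≤ ρ) {y z : E} (h : ‖y‖ + ρ ≤ S) :
    paraboloid ρ y z ≤ truncatedCone ρ S z := by
  refine max_le ?_ (le_max_right _ _)
  rcases le_total ρ ‖z - y‖ with hz | hz
  · refine le_max_of_le_right ?_
    have : ρ ^ 2 ≤ ‖z - y‖ ^ 2 := by gcongr
    linarith
  · refine le_max_of_le_left (le_min ?_ ?_)
    · nlinarith [sq_nonneg ‖z - y‖]
    · have h1 : ‖z‖ ≤ ‖y‖ + ‖z - y‖ := by
        calc ‖z‖ = ‖y + (z - y)‖ := by congr 1; abel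
          _ ≤ _ := norm_add_le _ _
      have h2 : ρ * (ρ - ‖z - y‖) ≤ ρ * (S - ‖z‖) :=
        mul_le_mul_of_nonneg_left (by linarith) hρ
      nlinarith [norm_nonneg (z - y), mul_nonneg hρ (norm_nonneg (z - y))]

/-- Truncated paraboloids with disjoint supports inside `B(0,S)` lie below the truncated cone. -/
theorem sum_paraboloid_le_truncatedCone {ρ S : ℝ} (hρ : 0 ≤ ρ) {ι : Type*} {s : Finset ι}
    {y : ι → E} (hy : ∀ i ∈ s, ‖y i‖ + ρ ≤ S)
    (hsep : ∀ i ∈ s, ∀ j ∈ s, i ≠ j → 2 * ρ ≤ dist (y i) (y j)) (z : E) :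
    ∑ i ∈ s, paraboloid ρ (y i) z ≤ truncatedCone ρ S z := by
  by_cases h : ∃ i ∈ s, ‖z - y i‖ < ρ
  · obtain ⟨i, hi, hz⟩ := h
    rw [Finset.sum_eq_single_of_mem i hi fun j hj hij => ?_]
    · exact paraboloid_le_truncatedCone hρ (hy i hi)
    · refine paraboloid_eq_zero hρ ?_
      have := hsep i hi j hj hij.symm
      have h3 := dist_triangle (y i) z (y j)
      rw [dist_comm (y i) z, dist_eq_norm z, dist_eq_norm z] at h3
      linarith
  · push Not at h
    rw [Finset.sum_eq_zero fun i hi => paraboloid_eq_zero hρ (h i hi)]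
    exact le_max_right _ _

theorem hasCompactSupport_paraboloid [ProperSpace E] {ρ : ℝ} (hρ : 0 ≤ ρ) (y : E) :
    HasCompactSupport (paraboloid ρ y) :=
  HasCompactSupport.intro (isCompact_closedBall y ρ) fun z hz => paraboloid_eq_zero hρ (by
    rw [mem_closedBall, dist_eq_norm, not_le] at hz
    exact hz.le)

theorem hasCompactSupport_truncatedCone [ProperSpace E] {ρ : ℝ} (hρ : 0 ≤ ρ) (S : ℝ) :
    HasCompactSupport (truncatedCone ρ S : E → ℝ) :=
  HasCompactSupport.intro (isCompact_closedBall 0 S) fun z hz => truncatedCone_eq_zero hρ (by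
    rw [mem_closedBall, dist_eq_norm, not_le, sub_zero] at hz
    exact hz.le)

end Bumps

/-! ### Gradients of the test functions and of `φ`. -/

section Gradients

variable {E : Type*} [NormedAddCommGroup E] [InnerProductSpace ℝ E] [CompleteSpace E]

theorem gradient_eq_zero_of_eventuallyEq_const {f : E → ℝ} {x : E} {c : ℝ}
    (h : f =ᶠ[𝓝 x] fun _ => c) : gradient f x = 0 := by
  rw [gradient, h.fderiv_eq]
  simp

theorem gradient_paraboloid_of_lt {ρ : ℝ} {y z : E} (h : ‖z - y‖ < ρ) :
    gradient (paraboloid ρ y) z = -(z - y) := by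
  have hev : paraboloid ρ y =ᶠ[𝓝 z] fun w => (ρ ^ 2 - ‖w - y‖ ^ 2) / 2 := by
    have hn : ∀ᶠ w in 𝓝 z, ‖w - y‖ < ρ :=
      (continuous_norm.comp (continuous_id.sub continuous_const)).continuousAt.eventually_lt_const h
    filter_upwards [hn] with w hw
    refine max_eq_left ?_
    have : ‖w - y‖ ^ 2 ≤ ρ ^ 2 := by gcongr
    linarith
  have hd : HasFDerivAt (fun w : E => (ρ ^ 2 - ‖w - y‖ ^ 2) / 2) (-innerSL ℝ (z - y)) z := by
    have h1 := (((hasFDerivAt_id z).sub_const y).norm_sq.const_sub (ρ ^ 2)).mul_const (1 / 2 : ℝ)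
    simp only [div_eq_mul_one_div (_ - _ : ℝ) 2]
    refine h1.congr_fderiv ?_
    ext v
    simp
  rw [gradient, hev.fderiv_eq, hd.fderiv, map_neg]
  congr 1
  exact (InnerProductSpace.toDual ℝ E).symm_apply_apply (z - y)

theorem gradient_paraboloid_of_gt {ρ : ℝ} (hρ : 0 ≤ ρ) {y z : E} (h : ρ < ‖z - y‖) :
    gradient (paraboloid ρ y) z = 0 := by
  refine gradient_eq_zero_of_eventuallyEq_const (c := 0) ?_
  have hn : ∀ᶠ w in 𝓝 z, ρ < ‖w - y‖ :=
    (continuous_norm.comp (continuous_id.sub continuous_const)).continuousAt.eventually_const_lt h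
  filter_upwards [hn] with w hw
  exact paraboloid_eq_zero hρ hw.le

theorem norm_gradient_le {f : E → ℝ} {C : ℝ≥0} (hf : LipschitzWith C f) (x : E) :
    ‖gradient f x‖ ≤ C := by
  rw [gradient, LinearIsometryEquiv.norm_map]
  exact norm_fderiv_le_of_lipschitz ℝ hf

theorem gradient_truncatedCone_eq_zero {ρ S : ℝ} (hρ : 0 ≤ ρ) {z : E}
    (h : z ∉ closedBall (0 : E) S \ ball 0 (S - ρ / 2)) :
    gradient (truncatedCone ρ S : E → ℝ) z = 0 := by
  rw [Set.mem_sdiff, not_and_or, not_not, mem_closedBall, mem_ball, dist_zero_right, not_le] at h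
  rcases h with h | h
  · refine gradient_eq_zero_of_eventuallyEq_const (c := 0) ?_
    filter_upwards [continuous_norm.continuousAt.eventually_const_lt h] with w hw
    exact truncatedCone_eq_zero hρ hw.le
  · refine gradient_eq_zero_of_eventuallyEq_const (c := ρ ^ 2 / 2) ?_
    filter_upwards [continuous_norm.continuousAt.eventually_lt_const h] with w hw
    exact truncatedCone_eq_of_le hρ hw.le

/-- The gradient of a convex function is a subgradient. -/
theorem sub_le_inner_gradient {φ : E → ℝ} (hφ : ConvexOn ℝ univ φ) {z : E}
    (hz : DifferentiableAt ℝ φ z) (y : E) : φ z - φ y ≤ inner ℝ (gradient φ z) (z - y) := by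
  have hg : ConvexOn ℝ univ fun s : ℝ => φ (z + s • (y - z)) := by
    have := hφ.comp_affineMap (AffineMap.lineMap z y)
    simpa [Function.comp_def, AffineMap.lineMap_apply, add_comm] using this
  have h1 := hg.le_slope_of_hasDerivAt (mem_univ 0) (mem_univ 1) zero_lt_one
    (hz.hasFDerivAt.hasLineDerivAt (y - z))
  have h2 : inner ℝ (gradient φ z) (z - y) = -fderiv ℝ φ z (y - z) := by
    rw [← map_neg, neg_sub]
    simp [gradient]
  rw [h2]
  simp only [slope_def_field, zero_smul, one_smul, add_zero, add_sub_cancel, sub_zero,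
    div_one] at h1
  linarith

end Gradients

/-! ### Lower bound on a paraboloid, upper bound on the cone. -/

section Integrals

variable {E : Type*} [NormedAddCommGroup E] [InnerProductSpace ℝ E] [FiniteDimensional ℝ E]
  [MeasurableSpace E] [BorelSpace E] {μ : Measure E} [μ.IsAddHaarMeasure]

/-- The integrand is odd about the centre of the ball. -/
theorem setIntegral_inner_sub_center (c g : E) (r : ℝ) :
    ∫ z in closedBall c r, inner ℝ g (z - c) ∂μ = 0 := by
  rw [← integral_indicator measurableSet_closedBall,
    ← integral_add_right_eq_self (μ := μ) _ c]
  have hodd : ∀ x : E, (closedBall c r).indicator (fun z => inner ℝ g (z - c)) (-x + c) =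
      -(closedBall c r).indicator (fun z => inner ℝ g (z - c)) (x + c) := fun x => by
    by_cases hx : ‖x‖ ≤ r
    · rw [indicator_of_mem (by simpa using hx), indicator_of_mem (by simpa using hx)]
      simp
    · rw [indicator_of_notMem (by simpa using hx), indicator_of_notMem (by simpa using hx)]
      simp
  have h := integral_neg_eq_self
    (fun x => (closedBall c r).indicator (fun z => inner ℝ g (z - c)) (x + c)) μ
  rw [integral_congr_ae (Eventually.of_forall hodd), integral_neg] at h
  linarith

theorem setIntegral_inner_sub (c g y : E) (r : ℝ) :
    ∫ z in closedBall c r, inner ℝ g (z - y) ∂μ = μ.real (closedBall c r) * inner ℝ g (c - y) := by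
  have h : ∀ z, inner ℝ g (z - y) = inner ℝ g (z - c) + inner ℝ g (c - y) := fun z => by
    rw [← inner_add_right, sub_add_sub_cancel]
  rw [integral_congr_ae (Eventually.of_forall h), integral_add, setIntegral_inner_sub_center]
  · simp
  · exact (by fun_prop : Continuous fun z : E => (inner ℝ g (z - c) : ℝ)).continuousOn
      |>.integrableOn_compact (isCompact_closedBall c r)
  · exact integrableOn_const (measure_closedBall_lt_top.ne)

theorem ae_inner_gradient_paraboloid {ρ : ℝ} (hρ : 0 < ρ) (φ : E → ℝ) (y : E) :
    ∀ᵐ z ∂μ, inner ℝ (gradient φ z) (gradient (paraboloid ρ y) z) =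
      -(closedBall y ρ).indicator (fun z => inner ℝ (gradient φ z) (z - y)) z := by
  have hs : ∀ᵐ z ∂μ, z ∉ sphere y ρ :=
    measure_eq_zero_iff_ae_notMem.1 (Measure.addHaar_sphere_of_ne_zero μ y hρ.ne')
  filter_upwards [hs] with z hz
  rw [mem_sphere, dist_eq_norm] at hz
  rcases lt_or_gt_of_ne hz with h | h
  · rw [gradient_paraboloid_of_lt h,
      indicator_of_mem (by rw [mem_closedBall, dist_eq_norm]; exact h.le),
      inner_neg_right]
  · rw [gradient_paraboloid_of_gt hρ.le h,
      indicator_of_notMem (by rw [mem_closedBall, dist_eq_norm]; exact h.not_ge)]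
    simp

/-- If `g₁` and `g₂` are subgradients of `φ` at `y₁` and `y₂` with `‖y₁ - y₂‖ ≤ δ`, the Laplacian
of `φ`, tested against a truncated paraboloid at `y₁`, is large. -/
theorem le_neg_integral_inner_gradient_paraboloid {φ : E → ℝ} {C : ℝ≥0}
    (hconv : ConvexOn ℝ univ φ) (hφ : LipschitzWith C φ) {y₁ y₂ g₁ g₂ : E}
    (h₁ : ∀ z, φ y₁ + inner ℝ g₁ (z - y₁) ≤ φ z) (h₂ : ∀ z, φ y₂ + inner ℝ g₂ (z - y₂) ≤ φ z)
    (hg : g₂ ≠ g₁) {δ s r : ℝ} (hδ : ‖y₁ - y₂‖ ≤ δ) (hs : 0 ≤ s) (hr : 0 < r) :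
    μ.real (closedBall (0 : E) r) * (‖g₂ - g₁‖ * (s - δ)) ≤
      -∫ z, inner ℝ (gradient φ z) (gradient (paraboloid (s + r) y₁) z) ∂μ := by
  have hρ : 0 < s + r := by linarith
  set e : E := ‖g₂ - g₁‖⁻¹ • (g₂ - g₁) with he
  have hg0 : ‖g₂ - g₁‖ ≠ 0 := norm_ne_zero_iff.2 (sub_ne_zero.2 hg)
  have he1 : ‖e‖ = 1 := by rw [he, norm_smul, norm_inv, norm_norm, inv_mul_cancel₀ hg0]
  have hge : inner ℝ (g₂ - g₁) e = ‖g₂ - g₁‖ := by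
    rw [he, inner_smul_right, real_inner_self_eq_norm_sq]; field_simp
  -- Moving from `y₁` in the direction of `g₂ - g₁` makes the second affine minorant exceed the
  -- first, by `‖g₂ - g₁‖ (s - δ)` at least.
  set c := y₁ + s • e with hc
  have hsub : closedBall c r ⊆ closedBall y₁ (s + r) := by
    refine closedBall_subset_closedBall' ?_
    rw [hc, dist_eq_norm, add_sub_cancel_left, norm_smul, he1, Real.norm_of_nonneg hs]
    linarith
  have hint := (integrable_inner_gradient (μ := μ) hφ
    (lipschitzWith_paraboloid hρ.le y₁) (hasCompactSupport_paraboloid hρ.le y₁))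
  have hpar := ae_inner_gradient_paraboloid (μ := μ) hρ φ y₁
  have hint' : IntegrableOn (fun z => inner ℝ (gradient φ z) (z - y₁))
      (closedBall y₁ (s + r)) μ := by
    rw [← integrable_indicator_iff measurableSet_closedBall]
    refine hint.neg.congr ?_
    filter_upwards [hpar] with z hz
    rw [Pi.neg_apply, hz, neg_neg]
  have hcont : ∀ g y c : E, ∀ r : ℝ, IntegrableOn (fun z => (inner ℝ g (z - y) : ℝ))
      (closedBall c r) μ := fun g y c r =>
    (by fun_prop : Continuous fun z : E => (inner ℝ g (z - y) : ℝ)).continuousOn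
      |>.integrableOn_compact (isCompact_closedBall c r)
  rw [integral_congr_ae hpar, integral_neg, neg_neg, integral_indicator measurableSet_closedBall]
  have hlow : μ.real (closedBall (0 : E) r) * (‖g₂ - g₁‖ * (s - δ)) ≤
      ∫ z in closedBall c r, inner ℝ (g₂ - g₁) (z - y₂) ∂μ := by
    rw [setIntegral_inner_sub, Measure.addHaar_real_closedBall_center μ c]
    refine mul_le_mul_of_nonneg_left ?_ measureReal_nonneg
    have e1 : c - y₂ = s • e + (y₁ - y₂) := by rw [hc]; abel
    rw [e1, inner_add_right, inner_smul_right, hge]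
    have := (abs_le.1 (abs_real_inner_le_norm (g₂ - g₁) (y₁ - y₂))).1
    nlinarith [mul_le_mul_of_nonneg_left hδ (norm_nonneg (g₂ - g₁))]
  refine hlow.trans ?_
  -- The `g₁` term has mean zero on the ball about `y₁`, so adding it costs nothing.
  have hind : ∫ z in closedBall c r, inner ℝ (g₂ - g₁) (z - y₂) ∂μ =
      ∫ z in closedBall y₁ (s + r), (inner ℝ g₁ (z - y₁) +
        (closedBall c r).indicator (fun z => inner ℝ (g₂ - g₁) (z - y₂)) z) ∂μ := by
    rw [integral_add (hcont _ _ _ _), setIntegral_inner_sub_center, zero_add,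
      setIntegral_indicator measurableSet_closedBall, inter_eq_right.2 hsub]
    exact ((integrable_indicator_iff measurableSet_closedBall).2 (hcont _ _ _ _)).integrableOn
  rw [hind]
  refine setIntegral_mono_ae (((hcont _ _ _ _).add
    ((integrable_indicator_iff measurableSet_closedBall).2 (hcont _ _ _ _)).integrableOn)) hint' ?_
  -- Pointwise, `⟪∇φ(z), z - y₁⟫ ≥ φ z - φ y₁`. On the small ball this is bounded below by chaining
  -- the subgradient inequalities from `y₁` to `y₂` and from `y₂` to `z`; elsewhere `g₁` alone is
  -- used.
  filter_upwards [hφ.ae_differentiableAt (μ := μ)] with z hz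
  refine le_trans ?_ (sub_le_inner_gradient hconv hz y₁)
  by_cases hzc : z ∈ closedBall c r
  · rw [indicator_of_mem hzc]
    have a := h₁ y₂
    have b := h₂ z
    have e2 : inner ℝ g₁ (z - y₁) = (inner ℝ g₁ (z - y₂) + inner ℝ g₁ (y₂ - y₁) : ℝ) := by
      rw [← inner_add_right, sub_add_sub_cancel]
    rw [e2, inner_sub_left]
    linarith
  · rw [indicator_of_notMem hzc]
    have a := h₁ z
    linarith

/-- Upper bound for the Laplacian of a Lipschitz function tested against a truncated cone. -/
theorem neg_integral_inner_gradient_truncatedCone_le {φ : E → ℝ} {C : ℝ≥0}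
    (hφ : LipschitzWith C φ) {ρ S : ℝ} (hρ : 0 ≤ ρ) (hS : ρ / 2 < S) :
    -∫ z, inner ℝ (gradient φ z) (gradient (truncatedCone ρ S) z) ∂μ ≤
      C * ρ * (μ.real (closedBall (0 : E) 1) *
        (S ^ Module.finrank ℝ E - (S - ρ / 2) ^ Module.finrank ℝ E)) := by
  set A := closedBall (0 : E) S \ ball 0 (S - ρ / 2) with hA
  have hAm : MeasurableSet A := measurableSet_closedBall.diff measurableSet_ball
  have hvol : μ.real A = μ.real (closedBall (0 : E) 1) *
      (S ^ Module.finrank ℝ E - (S - ρ / 2) ^ Module.finrank ℝ E) := by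
    rw [hA, measureReal_sdiff (ball_subset_closedBall.trans (closedBall_subset_closedBall
      (by linarith))) measurableSet_ball measure_closedBall_lt_top.ne,
      Measure.addHaar_real_closedBall' μ _ (by linarith), measureReal_def (s := ball _ _),
      Measure.addHaar_ball_of_pos μ _ (by linarith : 0 < S - ρ / 2), ENNReal.toReal_mul,
      ENNReal.toReal_ofReal (pow_nonneg (by linarith) _), measureReal_def,
      Measure.addHaar_unitClosedBall_eq_addHaar_unitBall]
    ring
  have hlip := lipschitzWith_truncatedCone (E := E) hρ S
  have hint := integrable_inner_gradient (μ := μ) hφ hlip (hasCompactSupport_truncatedCone hρ S)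
  rw [← hvol, ← integral_neg]
  have hle : ∀ z, -inner ℝ (gradient φ z) (gradient (truncatedCone ρ S) z) ≤
      A.indicator (fun _ => (C : ℝ) * ρ) z := fun z => by
    by_cases hz : z ∈ A
    · rw [indicator_of_mem hz]
      refine (neg_le_abs _).trans ((abs_real_inner_le_norm _ _).trans ?_)
      have h2 := norm_gradient_le hlip z
      rw [Real.coe_toNNReal _ hρ] at h2
      exact mul_le_mul (norm_gradient_le hφ z) h2 (norm_nonneg _) C.2
    · rw [indicator_of_notMem hz, gradient_truncatedCone_eq_zero hρ hz]
      simp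
  have hfin : μ A ≠ ∞ := (measure_mono_top sdiff_subset).mt measure_closedBall_lt_top.ne
  calc _ ≤ ∫ z, A.indicator (fun _ => (C : ℝ) * ρ) z ∂μ :=
        integral_mono hint.neg ((integrable_indicator_iff hAm).2 (integrableOn_const hfin)) hle
    _ = C * ρ * μ.real A := by
        rw [integral_indicator hAm, setIntegral_const, smul_eq_mul, mul_comm]

end Integrals

/-! ### Counting separated points. -/

theorem pow_sub_pow_le {S h : ℝ} (h0 : 0 ≤ h) (hS : h ≤ S) (d : ℕ) :
    S ^ d - (S - h) ^ d ≤ h * d * S ^ (d - 1) := by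
  have := (le_abs_self _).trans (abs_pow_sub_pow_le S (S - h) d)
  rwa [sub_sub_cancel, abs_of_nonneg h0, abs_of_nonneg (by linarith : 0 ≤ S),
    abs_of_nonneg (by linarith : 0 ≤ S - h), max_eq_left (by linarith)] at this

/-- The reciprocal is `(1 + 1/d)^d ≤ e < 3`. -/
theorem inv_three_le_div_pow {d : ℕ} (hd : 1 ≤ d) : (1 / 3 : ℝ) ≤ ((d : ℝ) / (d + 1)) ^ d := by
  have hd0 : (0 : ℝ) < d := by exact_mod_cast hd
  have h1 : ((d + 1 : ℝ) / d) ^ d ≤ 3 := by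
    calc ((d + 1 : ℝ) / d) ^ d ≤ Real.exp (1 / d) ^ d := by
          gcongr
          have := Real.add_one_le_exp (1 / (d : ℝ))
          calc ((d : ℝ) + 1) / d = 1 / d + 1 := by field_simp; ring
            _ ≤ _ := this
      _ = Real.exp 1 := by rw [← Real.exp_nat_mul]; congr 1; field_simp
      _ ≤ 3 := Real.exp_one_lt_three.le
  have h2 : ((d : ℝ) / (d + 1)) ^ d = 1 / ((d + 1 : ℝ) / d) ^ d := by
    rw [← one_div_pow, one_div_div]
  rw [h2]
  exact one_div_le_one_div_of_le (by positivity) h1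

variable {d : ℕ} {φ : EuclideanSpace ℝ (Fin d) → ℝ}

/-- The diameter is a supremum; taking `a < α` avoids having to show that it is attained. -/
theorem exists_subgradients_of_mem_nearSingularSet {x : EuclideanSpace ℝ (Fin d)} {η α a : ℝ}
    (hx : x ∈ nearSingularSet φ η α) (ha : 0 ≤ a) (haα : a < α) :
    ∃ y y' g g', dist y x ≤ η ∧ dist y' x ≤ η ∧ g ∈ subdifferential φ y ∧
      g' ∈ subdifferential φ y' ∧ a < ‖g' - g‖ := by
  by_contra! hcon
  have h : ediam (subdifferentialImage φ (closedBall x η)) ≤ ENNReal.ofReal a := by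
    refine ediam_le fun g' hg' g hg => ?_
    simp only [subdifferentialImage, mem_iUnion, mem_closedBall, exists_prop] at hg hg'
    obtain ⟨y, hy, hg⟩ := hg
    obtain ⟨y', hy', hg'⟩ := hg'
    rw [edist_dist, dist_eq_norm]
    exact ENNReal.ofReal_le_ofReal (hcon y y' g g' hy hy' hg hg')
  have h2 := ((ENNReal.ofReal_lt_ofReal_iff (ha.trans_lt haα)).2 haα).trans_le hx
  exact absurd h h2.not_ge

theorem card_mul_le_of_lt (hd : 1 ≤ d) (hconv : ConvexOn ℝ univ φ) {C : ℝ≥0}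
    (hφ : LipschitzWith C φ) {R α a η : ℝ} (hR : 0 < R) (hη : 0 < η) (ha : 0 < a) (haα : a < α)
    {s : Finset (EuclideanSpace ℝ (Fin d))}
    (hs : ∀ x ∈ s, x ∈ nearSingularSet φ η α ∩ closedBall 0 R)
    (hsep : ∀ x ∈ s, ∀ y ∈ s, x ≠ y → 8 * η ≤ dist x y) :
    (s.card : ℝ) * (a * η ^ (d - 1)) ≤ 48 * (d : ℝ) ^ 2 * (R + 4 * η) ^ (d - 1) * C := by
  have hd1 : (1 : ℝ) ≤ d := by exact_mod_cast hd
  have hch : ∀ x : EuclideanSpace ℝ (Fin d), ∃ y y' g g', x ∈ s → dist y x ≤ η ∧ dist y' x ≤ η ∧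
      g ∈ subdifferential φ y ∧ g' ∈ subdifferential φ y' ∧ a < ‖g' - g‖ := fun x => by
    by_cases hx : x ∈ s
    · obtain ⟨y, y', g, g', h⟩ :=
        exists_subgradients_of_mem_nearSingularSet (hs x hx).1 ha.le haα
      exact ⟨y, y', g, g', fun _ => h⟩
    · exact ⟨0, 0, 0, 0, fun h => absurd h hx⟩
  choose y y' g g' hyg using hch
  -- The centres `y x` lie within `η` of `B(0,R)` and the paraboloids have radius `3η`. Separation
  -- `8η` leaves at least `6η` between centres.
  set S := R + 4 * η with hS
  -- In the lower bound `δ = 2η` and `s = 2η + q`; this split maximizes `r ^ d * q` subject to `q +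
  -- r = η`.
  set q : ℝ := η / (d + 1) with hq
  set r : ℝ := η * (d / (d + 1)) with hr
  have hr0 : 0 < r := by positivity
  have hq0 : 0 < q := by positivity
  have hqr : 2 * η + q + r = 3 * η := by rw [hq, hr]; field_simp; ring
  set V := volume.real (closedBall (0 : EuclideanSpace ℝ (Fin d)) 1) with hV
  have hV0 : 0 < V :=
    ENNReal.toReal_pos (measure_closedBall_pos _ _ one_pos).ne' measure_closedBall_lt_top.ne
  have hle := sum_neg_integral_inner_gradient_le (μ := volume) (s := s) (φ := φ)
    (ψ₀ := truncatedCone (3 * η) S) (ψ := fun x => paraboloid (3 * η) (y x)) hconv hφ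
    (lipschitzWith_truncatedCone (by positivity) S)
    (hasCompactSupport_truncatedCone (by positivity) S)
    (fun x => lipschitzWith_paraboloid (by positivity) (y x))
    (fun x => hasCompactSupport_paraboloid (by positivity) (y x))
    (sum_paraboloid_le_truncatedCone (by positivity)
      (fun x hx => by
        have h1 := (hyg x hx).1
        have h2 := (hs x hx).2
        rw [mem_closedBall] at h2
        have h3 := dist_triangle (y x) x 0
        rw [dist_zero_right] at h3
        linarith)
      (fun x hx x' hx' hne => by
        have h1 := (hyg x hx).1
        have h2 := (hyg x' hx').1
        have h3 := hsep x hx x' hx' hne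
        have h4 := dist_triangle4 x (y x) (y x') x'
        rw [dist_comm x (y x)] at h4
        linarith))
  have hup := neg_integral_inner_gradient_truncatedCone_le (μ := volume) hφ
    (by positivity : 0 ≤ 3 * η) (by linarith : 3 * η / 2 < S)
  rw [finrank_euclideanSpace_fin, ← hV] at hup
  have hlow : ∀ x ∈ s, r ^ d * V * (a * q) ≤
      -∫ z, inner ℝ (gradient φ z) (gradient (paraboloid (3 * η) (y x)) z) := fun x hx => by
    obtain ⟨h1, h2, h3, h4, h5⟩ := hyg x hx
    have hyy : ‖y x - y' x‖ ≤ 2 * η := by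
      rw [← dist_eq_norm]
      have := dist_triangle_right (y x) (y' x) x
      linarith
    have hg : g' x ≠ g x := fun h => by
      rw [h, sub_self, norm_zero] at h5
      linarith
    have := le_neg_integral_inner_gradient_paraboloid (μ := volume) hconv hφ h3 h4 hg hyy
      (by positivity : 0 ≤ 2 * η + q) hr0
    rw [hqr, Measure.addHaar_real_closedBall' _ _ hr0.le, finrank_euclideanSpace_fin, ← hV,
      add_sub_cancel_left] at this
    refine le_trans ?_ this
    gcongr
  have hmain := (Finset.card_nsmul_le_sum s _ _ hlow).trans (hle.trans hup)
  rw [nsmul_eq_mul] at hmain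
  have hpow := pow_sub_pow_le (by positivity : 0 ≤ 3 * η / 2) (by linarith : 3 * η / 2 ≤ S) d
  have hS0 : 0 < S := by positivity
  have hrd : η ^ d * (1 / 3) ≤ r ^ d := by
    rw [hr, mul_pow]
    exact mul_le_mul_of_nonneg_left (inv_three_le_div_pow hd) (by positivity)
  have hηd : η ^ d = η * η ^ (d - 1) := by rw [← pow_succ', Nat.sub_add_cancel hd]
  have h1 : (s.card : ℝ) * (η ^ d * (1 / 3) * V * (a * q)) ≤
      C * (3 * η) * (V * (3 * η / 2 * d * S ^ (d - 1))) := by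
    refine le_trans ?_ (hmain.trans ?_)
    · gcongr
    · gcongr
  rw [hηd, hq] at h1
  have h2 : V * η ^ 2 / (3 * (d + 1)) * ((s.card : ℝ) * (a * η ^ (d - 1))) ≤
      V * η ^ 2 / (3 * (d + 1)) * (27 / 2 * (d * (d + 1)) * S ^ (d - 1) * C) := by
    calc _ = (s.card : ℝ) * (η * η ^ (d - 1) * (1 / 3) * V * (a * (η / (d + 1)))) := by
          field_simp
      _ ≤ _ := h1
      _ = _ := by field_simp; ring
  refine (le_of_mul_le_mul_left h2 (by positivity)).trans ?_
  -- Since `d + 1 ≤ 2d`, even `27 d²` would do.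
  have h3 : 27 / 2 * ((d : ℝ) * (d + 1)) ≤ 48 * (d : ℝ) ^ 2 := by nlinarith
  gcongr

theorem card_le_of_separated (hd : 1 ≤ d) (hconv : ConvexOn ℝ univ φ) {C : ℝ≥0}
    (hφ : LipschitzWith C φ) {R α η : ℝ} (hR : 0 < R) (hα : 0 < α) (hη : 0 < η)
    {s : Finset (EuclideanSpace ℝ (Fin d))}
    (hs : ∀ x ∈ s, x ∈ nearSingularSet φ η α ∩ closedBall 0 R)
    (hsep : ∀ x ∈ s, ∀ y ∈ s, x ≠ y → 8 * η ≤ dist x y) :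
    (s.card : ℝ) ≤
      48 * (d : ℝ) ^ 2 * (R + 4 * η) ^ (d - 1) * ((C : ℝ) / (α * η ^ (d - 1))) := by
  -- Let `a` increase to `α`.
  have hlim : Tendsto (fun a : ℝ => (s.card : ℝ) * (a * η ^ (d - 1))) (𝓝[<] α)
      (𝓝 ((s.card : ℝ) * (α * η ^ (d - 1)))) :=
    ((by fun_prop : Continuous fun a : ℝ => (s.card : ℝ) * (a * η ^ (d - 1))).tendsto α).mono_left
      nhdsWithin_le_nhds
  have h := le_of_tendsto hlim (b := 48 * (d : ℝ) ^ 2 * (R + 4 * η) ^ (d - 1) * C) (by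
    filter_upwards [Ioo_mem_nhdsLT hα] with a ha
    exact card_mul_le_of_lt hd hconv hφ hR hη ha.1 ha.2 hs hsep)
  rw [mul_div_assoc', le_div_iff₀ (by positivity)]
  exact h

/-! ### From separated sets to coverings and Hausdorff measure. -/

/-- A maximal `r`-separated subset gives a covering by open balls of radius `r`. -/
theorem exists_finset_cover_of_forall_separated_card_le {X : Type*} [PseudoMetricSpace X]
    {K : Set X} {r M : ℝ} (hr : 0 < r)
    (h : ∀ s : Finset X, (∀ x ∈ s, x ∈ K) → (∀ x ∈ s, ∀ y ∈ s, x ≠ y → r ≤ dist x y) →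
      (s.card : ℝ) ≤ M) :
    ∃ s : Finset X, K ⊆ (⋃ z ∈ (s : Set X), ball z r) ∧ (s.card : ℝ) ≤ M := by
  classical
  let A : Set ℕ := {n | ∃ s : Finset X, (∀ x ∈ s, x ∈ K) ∧
    (∀ x ∈ s, ∀ y ∈ s, x ≠ y → r ≤ dist x y) ∧ s.card = n}
  have hbdd : BddAbove A := ⟨⌊M⌋₊, fun n hn => by
    obtain ⟨s, h1, h2, rfl⟩ := hn
    exact Nat.le_floor (h s h1 h2)⟩
  have hne : A.Nonempty := ⟨0, ∅, by simp⟩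
  obtain ⟨s, h1, h2, h3⟩ := Nat.sSup_mem hne hbdd
  refine ⟨s, fun x hx => ?_, h s h1 h2⟩
  by_contra hcon
  simp only [mem_iUnion, Finset.mem_coe, mem_ball, exists_prop, not_exists, not_and, not_lt] at hcon
  have hxs : x ∉ s := fun hxs => by
    have := hcon x hxs
    rw [dist_self] at this
    linarith
  -- An uncovered point could be added to `s`, contradicting maximality of its cardinality.
  have hmem : s.card + 1 ∈ A := by
    refine ⟨insert x s, ?_, ?_, Finset.card_insert_of_notMem hxs⟩
    · intro z hz
      rcases Finset.mem_insert.1 hz with rfl | hz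
      exacts [hx, h1 z hz]
    · intro z hz w hw hzw
      rcases Finset.mem_insert.1 hz with rfl | hz' <;>
        rcases Finset.mem_insert.1 hw with rfl | hw'
      · exact absurd rfl hzw
      · exact hcon w hw'
      · rw [dist_comm]
        exact hcon z hz'
      · exact h2 z hz' w hw' hzw
  have := le_csSup hbdd hmem
  omega

theorem exists_finset_cover_nearSingularSet (hd : 1 ≤ d) (hconv : ConvexOn ℝ univ φ)
    (hφ : ∃ K : ℝ≥0, LipschitzWith K φ) {R α η : ℝ} (hR : 0 < R) (hα : 0 < α) (hη : 0 < η) :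
    ∃ s : Finset (EuclideanSpace ℝ (Fin d)),
      nearSingularSet φ η α ∩ closedBall 0 R ⊆
        (⋃ z ∈ (s : Set (EuclideanSpace ℝ (Fin d))), ball z (8 * η)) ∧
      (s.card : ℝ) ≤
        48 * (d : ℝ) ^ 2 * (R + 4 * η) ^ (d - 1) * ((lipConst φ : ℝ) / (α * η ^ (d - 1))) :=
  exists_finset_cover_of_forall_separated_card_le (by positivity) fun _ h1 h2 =>
    card_le_of_separated hd hconv (lipschitzWith_lipConst hφ) hR hα hη h1 h2

theorem singularSet_subset_nearSingularSet {η : ℝ} (hη : 0 ≤ η) (α : ℝ) :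
    singularSet φ α ⊆ nearSingularSet φ η α := fun _ hx =>
  le_trans hx (ediam_mono (subset_biUnion_of_mem (mem_closedBall_self hη)))

theorem hausdorffMeasure_singularSet_le (hd : 1 ≤ d) (hconv : ConvexOn ℝ univ φ)
    (hφ : ∃ K : ℝ≥0, LipschitzWith K φ) {R α : ℝ} (hR : 0 < R) (hα : 0 < α) :
    Measure.hausdorffMeasure ((d : ℝ) - 1) (singularSet φ α ∩ closedBall 0 R) ≤
      ENNReal.ofReal (48 * (d : ℝ) ^ 2 * 32 ^ (d - 1) *
        ((lipConst φ : ℝ) * R ^ (d - 1) / α)) := by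
  -- A null sequence with `R + 4η ≤ 2R` throughout.
  let η : ℕ → ℝ := fun n => R / 4 * (1 / (n + 1))
  have hη0 : ∀ n, 0 < η n := fun n => by positivity
  have hηR : ∀ n, η n ≤ R / 4 := fun n =>
    mul_le_of_le_one_right (by positivity) (by rw [div_le_one (by positivity)]; simp)
  have hηlim : Tendsto η atTop (𝓝 0) := by
    have := (tendsto_one_div_add_atTop_nhds_zero_nat (𝕜 := ℝ)).const_mul (R / 4)
    rwa [mul_zero] at this
  choose s hs hcard using fun n =>
    exists_finset_cover_nearSingularSet hd hconv hφ hR hα (hη0 n)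
  have hdiam : ∀ n, ∀ z : EuclideanSpace ℝ (Fin d),
      ediam (ball z (8 * η n)) ≤ ENNReal.ofReal (16 * η n) := fun n z => by
    refine ediam_le fun x hx y hy => ?_
    rw [edist_dist]
    refine ENNReal.ofReal_le_ofReal ?_
    have := dist_triangle_right x y z
    rw [mem_ball] at hx hy
    linarith
  have hlim : Tendsto (fun n => ENNReal.ofReal (16 * η n)) atTop (𝓝 0) := by
    have := ENNReal.tendsto_ofReal (hηlim.const_mul 16)
    simpa using this
  refine (Measure.hausdorffMeasure_le_liminf_sum ((d : ℝ) - 1) _ _ hlim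
    (fun n (z : s n) => ball (z : EuclideanSpace ℝ (Fin d)) (8 * η n))
    (Eventually.of_forall fun n z => hdiam n z)
    (Eventually.of_forall fun n x hx => ?_)).trans ?_
  · have := hs n ⟨singularSet_subset_nearSingularSet (hη0 n).le α hx.1, hx.2⟩
    simp only [mem_iUnion, Finset.mem_coe, exists_prop] at this
    obtain ⟨z, hz, hxz⟩ := this
    exact mem_iUnion.2 ⟨⟨z, hz⟩, hxz⟩
  · refine liminf_le_of_frequently_le' (Frequently.of_forall fun n => ?_)
    have hexp : (d : ℝ) - 1 = ((d - 1 : ℕ) : ℝ) := by rw [Nat.cast_sub hd, Nat.cast_one]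
    have h1 : ∑ z : s n, ediam (ball (z : EuclideanSpace ℝ (Fin d)) (8 * η n)) ^ ((d : ℝ) - 1) ≤
        ∑ _z : s n, ENNReal.ofReal ((16 * η n) ^ (d - 1)) := by
      refine Finset.sum_le_sum fun z _ => ?_
      rw [hexp, ENNReal.rpow_natCast, ENNReal.ofReal_pow (by have := hη0 n; positivity)]
      exact pow_le_pow_left' (hdiam n z) _
    refine h1.trans ?_
    rw [Finset.sum_const, Finset.card_univ, Fintype.card_coe, nsmul_eq_mul,
      ← ENNReal.ofReal_natCast, ← ENNReal.ofReal_mul (Nat.cast_nonneg _)]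
    refine ENNReal.ofReal_le_ofReal ?_
    have hp := hη0 n
    -- The powers of `η` cancel, so the bound is independent of `n`; `32` is `2` from `2R` times
    -- `16` from the ball diameters.
    calc ((s n).card : ℝ) * (16 * η n) ^ (d - 1)
        ≤ 48 * (d : ℝ) ^ 2 * (R + 4 * η n) ^ (d - 1) *
          ((lipConst φ : ℝ) / (α * η n ^ (d - 1))) * (16 * η n) ^ (d - 1) := by
          gcongr
          exact hcard n
      _ ≤ 48 * (d : ℝ) ^ 2 * (2 * R) ^ (d - 1) *
          ((lipConst φ : ℝ) / (α * η n ^ (d - 1))) * (16 * η n) ^ (d - 1) := by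
          gcongr
          linarith [hηR n]
      _ = _ := by
          rw [show (32 : ℝ) = 2 * 16 by norm_num]
          simp only [mul_pow]
          field_simp

end ConvexSingular

theorem theorem2p1 (d : ℕ) (hd : 1 ≤ d) :
    (∀ φ : EuclideanSpace ℝ (Fin d) → ℝ, ConvexOn ℝ Set.univ φ → (∃ K : ℝ≥0, LipschitzWith K φ) →
      ∀ R α η : ℝ, 0 < R → 0 < α → 0 < η →
        (ConvexSingular.openCoveringNumber
            (ConvexSingular.nearSingularSet φ η α ∩ Metric.closedBall 0 R) (8 * η) : ℝ≥0∞) ≤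
          ENNReal.ofReal
            (48 * (d : ℝ) ^ 2 * (R + 4 * η) ^ (d - 1) *
              ((ConvexSingular.lipConst φ : ℝ) / (α * η ^ (d - 1))))) ∧
    (∃ c : ℝ, 0 < c ∧
      ∀ φ : EuclideanSpace ℝ (Fin d) → ℝ, ConvexOn ℝ Set.univ φ → (∃ K : ℝ≥0, LipschitzWith K φ) →
        ∀ R α : ℝ, 0 < R → 0 < α →
          MeasureTheory.Measure.hausdorffMeasure ((d : ℝ) - 1)
              (ConvexSingular.singularSet φ α ∩ Metric.closedBall 0 R) ≤
            ENNReal.ofReal (c * ((ConvexSingular.lipConst φ : ℝ) * R ^ (d - 1) / α))) := by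
  refine ⟨fun φ hconv hφ R α η hR hα hη => ?_, 48 * (d : ℝ) ^ 2 * 32 ^ (d - 1), by positivity,
    fun φ hconv hφ R α hR hα =>
      ConvexSingular.hausdorffMeasure_singularSet_le hd hconv hφ hR hα⟩
  obtain ⟨s, hs, hcard⟩ :=
    ConvexSingular.exists_finset_cover_nearSingularSet hd hconv hφ hR hα hη
  have h1 : ConvexSingular.openCoveringNumber
      (ConvexSingular.nearSingularSet φ η α ∩ Metric.closedBall 0 R) (8 * η) ≤ (s.card : ℕ∞) :=
    (iInf₂_le (s : Set (EuclideanSpace ℝ (Fin d))) hs).trans (Set.encard_coe_eq_coe_finsetCard s).le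
  calc _ ≤ (((s.card : ℕ∞)) : ℝ≥0∞) := ENat.toENNReal_le.2 h1
    _ = ENNReal.ofReal (s.card : ℝ) := by simp
    _ ≤ _ := ENNReal.ofReal_le_ofReal hcard
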